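/- For every $p \ge \tfrac12$ there is a constant $c>0$, depending only on $p$, such that the following holds. Let $X$ be a measurable space and let $H$ be a class of measurable functions $X\to Y=\{+1,-1\}$ of VC dimension $d$ with $1<d<\infty$; if $d=2$, assume $p>\tfrac12$. Let $\eta,\epsilon>0$ satisfy $2\epsilon\le\eta\le\tfrac14$. Write $\operatorname{err}_D(h)=\mathbf P_{(x,y)\sim D}[h(x)\ne y]$. Then there is a finite nonempty indexed family $(D_i)_{i\in I}$ of probability distributions on $X\times Y$ such that (a) for every $i\in I$, the best error rate achievable by $H$ on $D_i$ is $\eta$, i.e. $\min_{h\in H}\operatorname{err}_{D_i}(h)=\eta$ (and the minimum is attained); (b) for every active learner, if $i$ is drawn uniformly from $I$ and the learner is run on an i.i.d. stream from $D_i$ (with $i$ not revealed), then the probability that it halts, having made at most $c\,d\,\eta^2/\epsilon^2$ label queries, and returns a classifier $h$ with $\operatorname{err}_{D_i}(h)\le\eta+\epsilon$, is less than $p$. In particular, with $p=\tfrac12$ and $d\ge 3$: no active learner making at most $c\,d\,\eta^2/\epsilon^2$ queries reaches error at most $\eta+\epsilon$ with probability at least $\tfrac12$ on every $D_i$; success with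 that probability takes $\Omega(d\eta^2/\epsilon^2)$ queries. For $d=2$ the same holds with any success probability $p>\tfrac12$ (the constant depending on $p$). Here an active learner is a randomized streaming procedure: it has a random seed, independent of the stream $(x_1,y_1),(x_2,y_2),\dots$; at each step it decides, from the seed and what it has observed so far, whether to halt and return a measurable classifier $h:X\to Y$ (not necessarily in $H$), or else to observe the next point $x_t$ and then decide whether to query its label $y_t$; all its decisions and the value $h(x)$ are jointly measurable functions of the seed, the observed history and the point $x_t$ (respectively $x$) concerned. -/

import Mathlib

open MeasureTheory

namespace ActiveLearning

/-- The label set `{+1, -1}` is represented by `Bool`, with `true` for `+1` and `false` for `-1`.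
What the learner gets back at a step is `some y` if it asked for the label and the label was `y`,
and `none` if it did not ask.  This finite type carries the discrete σ-algebra. -/
instance instMeasurableSpaceFeedback : MeasurableSpace (Option Bool) := ⊤

section Classification

variable {X : Type*}

/-- `H` shatters the finite set `S`: every labelling of `S` is realised by some `h ∈ H`. -/
def Shatters (H : Set (X → Bool)) (S : Finset X) : Prop :=
  ∀ b : X → Bool, ∃ h ∈ H, ∀ x ∈ S, h x = b x

/-- The Vapnik–Chervonenkis dimension: the supremum of the sizes of the shattered finite sets. -/
noncomputable def vcDim (H : Set (X → Bool)) : ℕ∞ :=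
  ⨆ (S : Finset X) (_ : Shatters H S), (S.card : ℕ∞)

/-- The error rate (expected 0-1 loss) of the classifier `h` on the distribution `D`. -/
noncomputable def err [MeasurableSpace X] (D : Measure (X × Bool)) (h : X → Bool) : ℝ :=
  D.real {z | h z.1 ≠ z.2}

end Classification

/-- What has been observed in the first `t` steps: the unlabelled points, and the labels of those
among them for which the label was requested. -/
abbrev History (X : Type*) (t : ℕ) : Type _ := Fin t → X × Option Bool

/-- A randomized active learner in the streaming setting, with random seed in `R`.
After each number `t` of steps it decides, from the seed and the history, whether to halt; if it
does not halt, it observes the next unlabelled point `x` and decides whether to request its label.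
When it halts after `t` steps, it returns the classifier `output t`. -/
structure ActiveLearner (R X : Type*) [MeasurableSpace R] [MeasurableSpace X] where
  halt : (t : ℕ) → R → History X t → Bool
  query : (t : ℕ) → R → History X t → X → Bool
  output : (t : ℕ) → R → History X t → X → Bool
  measurable_halt : ∀ t, Measurable fun q : R × History X t => halt t q.1 q.2
  measurable_query : ∀ t, Measurable fun q : (R × History X t) × X => query t q.1.1 q.1.2 q.2
  measurable_output : ∀ t, Measurable fun q : (R × History X t) × X => output t q.1.1 q.1.2 q.2

namespace ActiveLearner

variable {R X : Type*} [MeasurableSpace R] [MeasurableSpace X]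

/-- The history after `t` steps, for the seed `r` and the stream `z` of labelled examples (of which
the learner sees the labels it requests only). -/
def history (A : ActiveLearner R X) (r : R) (z : ℕ → X × Bool) : (t : ℕ) → History X t
  | 0 => Fin.elim0
  | t + 1 => Fin.snoc (α := fun _ => X × Option Bool) (A.history r z t)
      ((z t).1, if A.query t r (A.history r z t) (z t).1 then some (z t).2 else none)

/-- The number of labels requested in the first `t` steps. -/
def numQueries (A : ActiveLearner R X) (r : R) (z : ℕ → X × Bool) (t : ℕ) : ℕ :=
  ((Finset.range t).filter fun s => A.query s r (A.history r z s) (z s).1 = true).card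

/-- The learner halts after exactly `t` steps. -/
def HaltsAt (A : ActiveLearner R X) (r : R) (z : ℕ → X × Bool) (t : ℕ) : Prop :=
  A.halt t r (A.history r z t) = true ∧ ∀ s < t, A.halt s r (A.history r z s) = false

/-- The event (a set of pairs of a seed and a stream) that the learner halts, having requested at
most `m` labels, and returns a classifier whose error rate on `D` is at most `a`. -/
def successEvent (A : ActiveLearner R X) (D : Measure (X × Bool)) (a m : ℝ) :
    Set (R × (ℕ → X × Bool)) :=
  {ω | ∃ t, A.HaltsAt ω.1 ω.2 t ∧ (A.numQueries ω.1 ω.2 t : ℝ) ≤ m ∧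
    err D (A.output t ω.1 (A.history ω.1 ω.2 t)) ≤ a}

/-- The probability of `successEvent` when the seed has law `ρ` and the stream consists of
independent examples drawn from `D`, independent of the seed. -/
noncomputable def successProb (A : ActiveLearner R X) (ρ : Measure R)
    (D : ProbabilityMeasure (X × Bool)) (a m : ℝ) : ℝ :=
  (ρ.prod (Measure.infinitePi fun _ : ℕ => (D : Measure (X × Bool)))).real
    (A.successEvent (D : Measure (X × Bool)) a m)

end ActiveLearner

end ActiveLearning

/-! Put a distribution on `d = n + 1` shattered points. One has mass `1 - β` and a certain label;
the other `n` share mass `β`, and the label of the `i`-th is `b i` with probability `1/2 + γ`, where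
`b` is hidden in the cube. With `β = 2η + 4ε` and `βγ = 2ε` the best error is `η`, and each wrong
coordinate costs `4ε/n` more. Error at most `η + ε` thus forces a guess of `b` with at most `n/4`
mistakes.

Compare with fair labels, which carry no information on `b`. There, each transcript succeeds only
for `b` in one Hamming ball, a fraction at most `ρ = (337/384)^n` of the cube
(`card_mistakes_le_pow`). Biasing the labels inserts the likelihood ratio `L` of the revealed labels
alone, and `M` labels give `E L² ≤ (1 + 4γ²)^M` (`expect_likelihood_sq_div_le`). Averaged over `b`,
this raises the success probability by at most about `√(ρ((1 + 4γ²)^M - 1))` (`sum_expect_le`).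
Since `ρ` decays exponentially in `n`, the increase stays small until `M` is of order `n/γ²`, that
is `dη²/ε²` (`exists_rate`).

The reduction from measurable randomized learners to finite sums is
`ActiveLearner.sum_successProb_le`: condition on the seed, cap the labels, and truncate the stream.
-/

namespace ActiveLearning

/-! ### Change of measure for transcripts on a finite set of points -/

section Transcript

variable {J : Type*}

/-- What the learner sees at a step, when `q` says for which points it requests the label. -/
def feedback (q : J → Bool) (k : J × Bool) : J × Option Bool :=
  (k.1, if q k.1 then some k.2 else none)

/-- The history generated by the query rule `q` on a finite stream. -/
def transcript (q : (t : ℕ) → History J t → J → Bool) : (t : ℕ) → (Fin t → J × Bool) → History J t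
  | 0, _ => Fin.elim0
  | t + 1, z => Fin.snoc (α := fun _ => J × Option Bool) (transcript q t (Fin.init z))
      (feedback (q t (transcript q t (Fin.init z))) (z (Fin.last t)))

/-- The number of revealed labels in a history. -/
def numLabels {t : ℕ} (h : History J t) : ℕ := ∑ i, if (h i).2.isSome then 1 else 0

/-- The product of the factors `ℓ` over the revealed labels of a history. -/
def likelihood (ℓ : J × Bool → ℝ) {t : ℕ} (h : History J t) : ℝ :=
  ∏ i, (h i).2.elim 1 fun y => ℓ ((h i).1, y)

lemma numLabels_snoc {t : ℕ} (h : History J t) (a : J × Option Bool) :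
    numLabels (t := t + 1) (Fin.snoc (α := fun _ => J × Option Bool) h a)
      = numLabels h + if a.2.isSome then 1 else 0 := by
  rw [numLabels, numLabels, Fin.sum_univ_castSucc]
  simp only [Fin.snoc_castSucc, Fin.snoc_last]

lemma likelihood_snoc (ℓ : J × Bool → ℝ) {t : ℕ} (h : History J t) (a : J × Option Bool) :
    likelihood ℓ (t := t + 1) (Fin.snoc (α := fun _ => J × Option Bool) h a)
      = likelihood ℓ h * a.2.elim 1 fun y => ℓ (a.1, y) := by
  simp [likelihood, Fin.prod_univ_castSucc]

/-- The query rule `q`, capped at `M` labels. -/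
def capped (q : (t : ℕ) → History J t → J → Bool) (M : ℕ) (t : ℕ) (h : History J t) (j : J) :
    Bool :=
  q t h j && decide (numLabels h < M)

lemma numLabels_transcript_capped (q : (t : ℕ) → History J t → J → Bool) (M t : ℕ)
    (z : Fin t → J × Bool) : numLabels (transcript (capped q M) t z) ≤ M := by
  induction t with
  | zero => simp [numLabels]
  | succ t ih =>
    rw [transcript, numLabels_snoc]
    have := ih (Fin.init z)
    simp only [feedback, capped]
    by_cases h : numLabels (transcript (capped q M) t (Fin.init z)) < M
    · refine le_trans (Nat.add_le_add_left (m := 1) ?_ _) h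
      by_cases h' : q t (transcript (capped q M) t (Fin.init z)) (z (Fin.last t)).1 <;> simp [h, h']
    · simpa [h] using this

variable [Fintype J]

/-- The expectation of a function of the history after `t` steps, for a stream of independent
examples with weights `μ`. -/
noncomputable def expect (μ : J × Bool → ℝ) (q : (t : ℕ) → History J t → J → Bool) (t : ℕ)
    (f : History J t → ℝ) : ℝ :=
  ∑ z : Fin t → J × Bool, (∏ s, μ (z s)) * f (transcript q t z)

lemma expect_succ (μ : J × Bool → ℝ) (q : (t : ℕ) → History J t → J → Bool) (t : ℕ)
    (f : History J (t + 1) → ℝ) :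
    expect μ q (t + 1) f = expect μ q t fun h => ∑ k, μ k *
      f (Fin.snoc (α := fun _ => J × Option Bool) h (feedback (q t h) k)) := by
  simp only [expect]
  rw [← (Fin.snocEquiv fun _ : Fin (t + 1) => J × Bool).sum_comp, Fintype.sum_prod_type_right]
  refine Finset.sum_congr rfl fun z _ => ?_
  rw [Finset.mul_sum]
  refine Finset.sum_congr rfl fun k _ => ?_
  simp [Fin.snocEquiv, transcript, Fin.prod_univ_castSucc, mul_assoc]

lemma expect_mono {μ : J × Bool → ℝ} (hμ : ∀ k, 0 ≤ μ k) (q : (t : ℕ) → History J t → J → Bool)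
    (t : ℕ) {f g : History J t → ℝ} (h : ∀ z, f (transcript q t z) ≤ g (transcript q t z)) :
    expect μ q t f ≤ expect μ q t g :=
  Finset.sum_le_sum fun z _ =>
    mul_le_mul_of_nonneg_left (h z) (Finset.prod_nonneg fun s _ => hμ (z s))

lemma expect_add (μ : J × Bool → ℝ) (q : (t : ℕ) → History J t → J → Bool) (t : ℕ)
    (f g : History J t → ℝ) :
    expect μ q t (fun h => f h + g h) = expect μ q t f + expect μ q t g := by
  simp [expect, mul_add, Finset.sum_add_distrib]

lemma expect_const_mul (μ : J × Bool → ℝ) (q : (t : ℕ) → History J t → J → Bool) (t : ℕ) (a : ℝ)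
    (f : History J t → ℝ) : expect μ q t (fun h => a * f h) = a * expect μ q t f := by
  simp only [expect, Finset.mul_sum]
  exact Finset.sum_congr rfl fun _ _ => by ring

lemma expect_sum {B : Type*} (s : Finset B) (μ : J × Bool → ℝ)
    (q : (t : ℕ) → History J t → J → Bool) (t : ℕ) (f : B → History J t → ℝ) :
    expect μ q t (fun h => ∑ b ∈ s, f b h) = ∑ b ∈ s, expect μ q t (f b) := by
  simp only [expect, Finset.mul_sum]
  exact Finset.sum_comm

lemma expect_const {μ : J × Bool → ℝ} (hμ : ∑ k, μ k = 1) (q : (t : ℕ) → History J t → J → Bool)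
    (t : ℕ) (a : ℝ) : expect μ q t (fun _ => a) = a := by
  induction t with
  | zero => simp [expect]
  | succ t ih => rw [expect_succ, ← Finset.sum_mul, hμ, one_mul, ih]

/-- Change of measure: only the revealed labels contribute to the likelihood ratio. -/
lemma expect_mul_likelihood (μ ℓ : J × Bool → ℝ)
    (hℓ : ∀ j, ∑ y, μ (j, y) * ℓ (j, y) = ∑ y, μ (j, y))
    (q : (t : ℕ) → History J t → J → Bool) (t : ℕ) (f : History J t → ℝ) :
    expect (fun k => μ k * ℓ k) q t f = expect μ q t fun h => f h * likelihood ℓ h := by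
  induction t with
  | zero => simp [expect, likelihood]
  | succ t ih =>
    rw [expect_succ, expect_succ, ih]
    congr 1
    funext h
    rw [Finset.sum_mul, Fintype.sum_prod_type, Fintype.sum_prod_type]
    refine Finset.sum_congr rfl fun j _ => ?_
    have := hℓ j
    simp only [Fintype.sum_bool] at this ⊢
    simp only [likelihood_snoc, feedback]
    cases q t h j
    · simp only [Bool.false_eq_true, if_false, Option.elim_none]
      linear_combination (f (Fin.snoc (α := fun _ => J × Option Bool) h (j, none))
        * likelihood ℓ h) * this
    · simp only [if_true, Option.elim_some]
      ring

/-- A supermartingale argument: a revealed label multiplies the conditional mean of the squared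
likelihood by at most `κ`, which the new factor `κ⁻¹` absorbs; an unrevealed label changes nothing.
-/
lemma expect_likelihood_sq_div_le {μ : J × Bool → ℝ} (hμ : ∀ k, 0 ≤ μ k) (hμ1 : ∑ k, μ k = 1)
    (ℓ : J × Bool → ℝ) {κ : ℝ} (hκ : 1 ≤ κ)
    (hℓ : ∀ j, ∑ y, μ (j, y) * ℓ (j, y) ^ 2 ≤ κ * ∑ y, μ (j, y))
    (q : (t : ℕ) → History J t → J → Bool) (t : ℕ) :
    expect μ q t (fun h => likelihood ℓ h ^ 2 * (κ⁻¹) ^ numLabels h) ≤ 1 := by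
  have hκ0 : 0 < κ := by linarith
  induction t with
  | zero => simp [expect, likelihood, numLabels]
  | succ t ih =>
    rw [expect_succ]
    refine (expect_mono hμ q t fun z => ?_).trans ih
    generalize transcript q t z = h
    set a := likelihood ℓ h ^ 2 * (κ⁻¹) ^ numLabels h with ha
    have ha0 : 0 ≤ a := by positivity
    calc _ ≤ ∑ j, a * ∑ y, μ (j, y) := by
          rw [Fintype.sum_prod_type]
          refine Finset.sum_le_sum fun j _ => ?_
          have h1 := hℓ j
          simp only [Fintype.sum_bool] at h1 ⊢
          simp only [likelihood_snoc, numLabels_snoc, feedback]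
          cases q t h j
          · simp only [Bool.false_eq_true, if_false, Option.elim_none, Option.isSome_none,
              mul_one, add_zero]
            rw [← ha]
            linarith
          · simp only [if_true, Option.elim_some, Option.isSome_some, pow_add, pow_one, mul_pow]
            have h2 := mul_le_mul_of_nonneg_left h1 (mul_nonneg ha0 (inv_pos.2 hκ0).le)
            have h3 : a * κ⁻¹ * (κ * (μ (j, true) + μ (j, false)))
                = a * (μ (j, true) + μ (j, false)) := by field_simp
            rw [h3] at h2
            refine le_trans (le_of_eq ?_) h2
            rw [ha]
            ring
      _ = a := by
          rw [← Finset.mul_sum, ← Fintype.sum_prod_type, hμ1, mul_one]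

/-- A learner that sees at most `M` labels cannot do much better under the alternatives `μ * ℓ b`
than it does under `μ`, where it learns nothing about `b`. -/
lemma sum_expect_le {B : Type*} [Fintype B] {μ : J × Bool → ℝ} (hμ : ∀ k, 0 ≤ μ k)
    (hμ1 : ∑ k, μ k = 1) (ℓ : B → J × Bool → ℝ) {κ : ℝ} (hκ : 1 ≤ κ)
    (hℓ1 : ∀ b j, ∑ y, μ (j, y) * ℓ b (j, y) = ∑ y, μ (j, y))
    (hℓ2 : ∀ b j, ∑ y, μ (j, y) * ℓ b (j, y) ^ 2 ≤ κ * ∑ y, μ (j, y))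
    (q : (t : ℕ) → History J t → J → Bool) (M t : ℕ) (f : B → History J t → ℝ)
    (hf0 : ∀ b h, f b h = 0 ∨ f b h = 1) {C : ℝ} (hC : ∀ h, ∑ b, f b h ≤ C) {lam : ℝ}
    (hlam : 0 < lam) :
    ∑ b, expect (fun k => μ k * ℓ b k) (capped q M) t (f b)
      ≤ C + lam * C / 2 + Fintype.card B * ((κ ^ M - 1) / (2 * lam)) := by
  have hκ0 : 0 < κ := by linarith
  have hL1 : ∀ b, expect μ (capped q M) t (likelihood (ℓ b)) = 1 := fun b => by
    have := expect_mul_likelihood μ (ℓ b) (hℓ1 b) (capped q M) t fun _ => 1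
    simp only [one_mul] at this
    rw [← this]
    refine expect_const ?_ _ _ _
    rw [← hμ1, Fintype.sum_prod_type, Fintype.sum_prod_type]
    exact Finset.sum_congr rfl fun j _ => hℓ1 b j
  have hL2 : ∀ b, expect μ (capped q M) t (fun h => likelihood (ℓ b) h ^ 2) ≤ κ ^ M := fun b => by
    calc _ ≤ expect μ (capped q M) t
          (fun h => κ ^ M * (likelihood (ℓ b) h ^ 2 * (κ⁻¹) ^ numLabels h)) := by
          refine expect_mono hμ _ t fun z => ?_
          have hN := pow_le_pow_right₀ hκ (numLabels_transcript_capped q M t z)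
          generalize transcript (capped q M) t z = h at hN ⊢
          rw [inv_pow, mul_left_comm]
          refine le_mul_of_one_le_right (sq_nonneg _) ?_
          rw [← div_eq_mul_inv, one_le_div (by positivity)]
          exact hN
      _ ≤ κ ^ M := by
          rw [expect_const_mul]
          exact mul_le_of_le_one_right (by positivity)
            (expect_likelihood_sq_div_le hμ hμ1 (ℓ b) hκ (hℓ2 b) _ t)
  -- Expand `(L - 1 - lam * f)² ≥ 0` and use `f² = f`. The terms in `L` alone are `(L - 1)² / (2 *
  -- lam)`, of mean at most `(κ ^ M - 1) / (2 * lam)`.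
  have hpt : ∀ b h, f b h * likelihood (ℓ b) h ≤ (1 + lam / 2) * f b h
      + ((2 * lam)⁻¹ * likelihood (ℓ b) h ^ 2 + (-lam⁻¹ * likelihood (ℓ b) h + (2 * lam)⁻¹)) := by
    intro b h
    have key : 0 ≤ (2 * lam)⁻¹ * (likelihood (ℓ b) h - 1 - lam * f b h) ^ 2 := by positivity
    have hsq : f b h ^ 2 = f b h := by rcases hf0 b h with h | h <;> simp [h]
    have e : (2 * lam)⁻¹ * (likelihood (ℓ b) h - 1 - lam * f b h) ^ 2
        = (2 * lam)⁻¹ * likelihood (ℓ b) h ^ 2 + (-lam⁻¹ * likelihood (ℓ b) h + (2 * lam)⁻¹)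
          - f b h * likelihood (ℓ b) h + f b h + lam / 2 * f b h ^ 2 := by
      field_simp
      ring
    rw [e, hsq] at key
    linarith
  calc _ = ∑ b, expect μ (capped q M) t (fun h => f b h * likelihood (ℓ b) h) :=
        Finset.sum_congr rfl fun b _ => expect_mul_likelihood μ (ℓ b) (hℓ1 b) _ t (f b)
    _ ≤ ∑ b, ((1 + lam / 2) * expect μ (capped q M) t (f b) + (κ ^ M - 1) / (2 * lam)) := by
        refine Finset.sum_le_sum fun b _ => ?_
        refine (expect_mono hμ (capped q M) t (g := fun h => (1 + lam / 2) * f b h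
          + ((2 * lam)⁻¹ * likelihood (ℓ b) h ^ 2
            + (-lam⁻¹ * likelihood (ℓ b) h + (2 * lam)⁻¹))) fun z => hpt b _).trans ?_
        rw [expect_add, expect_add, expect_add, expect_const_mul, expect_const_mul,
          expect_const_mul, expect_const hμ1, hL1 b]
        have := mul_le_mul_of_nonneg_left (hL2 b) (a := (2 * lam)⁻¹) (by positivity)
        have e : (κ ^ M - 1) / (2 * lam) = (2 * lam)⁻¹ * κ ^ M + (-lam⁻¹ * 1 + (2 * lam)⁻¹) := by
          field_simp
          ring
        rw [e]
        linarith
    _ = (1 + lam / 2) * expect μ (capped q M) t (fun h => ∑ b, f b h)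
          + Fintype.card B * ((κ ^ M - 1) / (2 * lam)) := by
        rw [Finset.sum_add_distrib, ← Finset.mul_sum, expect_sum]
        simp
    _ ≤ _ := by
        have h1 : expect μ (capped q M) t (fun h => ∑ b, f b h) ≤ C :=
          (expect_mono hμ _ t fun z => hC _).trans (expect_const hμ1 _ t C).le
        have := mul_le_mul_of_nonneg_left h1 (a := 1 + lam / 2) (by positivity)
        linarith

end Transcript

/-! ### Finite-horizon events of an i.i.d. stream -/

section FiniteStream

variable {K : Type*} [Fintype K] [MeasurableSpace K] [MeasurableSingletonClass K]

open Classical in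
lemma infinitePi_real_prefix (ν : Measure K) [IsProbabilityMeasure ν] (t : ℕ)
    (G : Set (Fin t → K)) :
    (Measure.infinitePi fun _ : ℕ => ν).real {w | (fun s : Fin t => w s) ∈ G}
      = ∑ z, (∏ s, ν.real {z s}) * if z ∈ G then 1 else 0 := by
  have hf : Measurable fun (w : ℕ → K) (s : Fin t) => w s := by fun_prop
  have hs : ∀ z : Fin t → K, ((Measure.infinitePi fun _ : ℕ => ν).map
      fun (w : ℕ → K) (s : Fin t) => w s).real {z} = ∏ s, ν.real {z s} := fun z => by
    rw [map_measureReal_apply hf (measurableSet_singleton z)]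
    have : (fun (w : ℕ → K) (s : Fin t) => w s) ⁻¹' {z}
        = Set.pi (Finset.range t) fun s => {k | ∀ h : s < t, k = z ⟨s, h⟩} := by
      ext w
      simp only [Set.mem_preimage, Set.mem_singleton_iff, funext_iff, Set.mem_pi,
        Finset.coe_range, Set.mem_Iio, Set.mem_ofPred_eq]
      exact ⟨fun h s _ hs => h ⟨s, hs⟩, fun h s => h s s.2 s.2⟩
    rw [this, measureReal_def, Measure.infinitePi_pi _ fun s _ => (Set.toFinite _).measurableSet,
      ENNReal.toReal_prod, Finset.prod_range]
    refine Finset.prod_congr rfl fun s _ => ?_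
    simp [measureReal_def]
  have h1 := map_measureReal_apply (μ := Measure.infinitePi fun _ : ℕ => ν) hf
    (s := G) G.toFinite.measurableSet
  rw [Set.preimage] at h1
  rw [← h1, ← G.toFinite.coe_toFinset, ← sum_measureReal_singleton]
  simp [hs, ← Finset.sum_filter]
  refine Finset.sum_congr ?_ fun _ _ => rfl
  ext
  simp

end FiniteStream

/-! ### From a learner on `X` to transcripts over indices; measurability -/

section Discretization

variable {X J : Type*}

/-- The history over `X` that corresponds to a history over a type `J` of indices of points. -/
def embed (pt : J → X) {t : ℕ} (h : History J t) : History X t := fun i => (pt (h i).1, (h i).2)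

lemma embed_snoc (pt : J → X) {t : ℕ} (h : History J t) (a : J × Option Bool) :
    embed pt (t := t + 1) (Fin.snoc (α := fun _ => J × Option Bool) h a)
      = Fin.snoc (α := fun _ => X × Option Bool) (embed pt h) (pt a.1, a.2) := by
  funext i
  refine Fin.lastCases ?_ (fun i => ?_) i <;> simp [embed]

lemma numLabels_embed (pt : J → X) {t : ℕ} (h : History J t) :
    numLabels (embed pt h) = numLabels h := rfl

namespace ActiveLearner

variable {R : Type*} [MeasurableSpace R] [MeasurableSpace X]

/-- The query rule that a learner with a fixed seed follows on the points `pt j`. -/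
def queryRule (A : ActiveLearner R X) (r : R) (pt : J → X) (t : ℕ) (h : History J t) (j : J) :
    Bool :=
  A.query t r (embed pt h) (pt j)

/-- The classifier returned within the first `t` steps, if any. -/
def decision (A : ActiveLearner R X) (r : R) (pt : J → X) : (t : ℕ) → History J t → Option (X → Bool)
  | 0, h => if A.halt 0 r (embed pt h) then some (A.output 0 r (embed pt h)) else none
  | t + 1, h => (decision A r pt t (Fin.init h)).or
      (if A.halt (t + 1) r (embed pt h) then some (A.output (t + 1) r (embed pt h)) else none)

lemma decision_transcript_succ (A : ActiveLearner R X) (r : R) (pt : J → X)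
    (q : (t : ℕ) → History J t → J → Bool) (w : ℕ → J × Bool) (t : ℕ) :
    A.decision r pt (t + 1) (transcript q (t + 1) fun s => w s)
      = (A.decision r pt t (transcript q t fun s => w s)).or
        (if A.halt (t + 1) r (embed pt (transcript q (t + 1) fun s => w s)) then
          some (A.output (t + 1) r (embed pt (transcript q (t + 1) fun s => w s))) else none) := by
  rw [decision]
  congr 2
  rw [transcript, Fin.init_snoc]
  rfl

lemma numQueries_eq_numLabels (A : ActiveLearner R X) (r : R) (z : ℕ → X × Bool) (t : ℕ) :
    A.numQueries r z t = numLabels (A.history r z t) := by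
  induction t with
  | zero => simp [numQueries, numLabels]
  | succ t ih =>
    rw [history, numLabels_snoc, ← ih, numQueries, numQueries, Finset.range_add_one,
      Finset.filter_insert]
    split_ifs <;> simp_all

lemma numQueries_mono (A : ActiveLearner R X) (r : R) (z : ℕ → X × Bool) :
    Monotone (A.numQueries r z) := fun _ _ h =>
  Finset.card_le_card (Finset.filter_subset_filter _ (Finset.range_subset_range.2 h))

lemma numQueries_succ (A : ActiveLearner R X) (r : R) (z : ℕ → X × Bool) (t : ℕ) :
    A.numQueries r z (t + 1) = A.numQueries r z t
      + if A.query t r (A.history r z t) (z t).1 then 1 else 0 := by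
  rw [numQueries, numQueries, Finset.range_add_one, Finset.filter_insert]
  split_ifs <;> simp_all

/-- The cap is inactive along this history: a query at step `t` with at most `M` queries after it
means fewer than `M` before it, which is exactly what `capped` tests. -/
lemma history_eq_embed (A : ActiveLearner R X) (r : R) (pt : J → X) (w : ℕ → J × Bool) {M t : ℕ}
    (hM : A.numQueries r (fun s => (pt (w s).1, (w s).2)) t ≤ M) :
    A.history r (fun s => (pt (w s).1, (w s).2)) t
      = embed pt (transcript (capped (A.queryRule r pt) M) t fun s => w s) := by
  induction t with
  | zero => exact funext fun i => i.elim0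
  | succ t ih =>
    have ih := ih ((A.numQueries_mono r _ t.le_succ).trans hM)
    have hi : (Fin.init fun s : Fin (t + 1) => w s) = fun s : Fin t => w s := rfl
    have hc : capped (A.queryRule r pt) M t
        (transcript (capped (A.queryRule r pt) M) t fun s => w s) (w t).1
        = A.query t r (A.history r (fun s => (pt (w s).1, (w s).2)) t) (pt (w t).1) := by
      rw [capped, queryRule, ← ih, ← numLabels_embed pt, ← ih, ← numQueries_eq_numLabels]
      rw [numQueries_succ] at hM
      by_cases hq : A.query t r (A.history r (fun s => (pt (w s).1, (w s).2)) t) (pt (w t).1) = true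
      · have : A.numQueries r (fun s => (pt (w s).1, (w s).2)) t < M := by
          simp only [hq, if_true] at hM
          omega
        simp [hq, this]
      · simp [hq]
    rw [history, transcript, embed_snoc, hi, ← ih]
    simp only [feedback, Fin.val_last, hc]

/-- A successful run never exceeds its label budget, so capping does not alter it, and success
becomes visible in a finite prefix of the stream. -/
lemma exists_decision_of_mem_successEvent (A : ActiveLearner R X) (r : R) (pt : J → X)
    (w : ℕ → J × Bool) (D : Measure (X × Bool)) {a m : ℝ}
    (h : (r, fun s => (pt (w s).1, (w s).2)) ∈ A.successEvent D a m) :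
    ∃ t, ∃ g ∈ A.decision r pt t (transcript (capped (A.queryRule r pt) ⌊m⌋₊) t fun s => w s),
      err D g ≤ a := by
  obtain ⟨t, ⟨hh, hn⟩, hm, he⟩ := h
  have hM := Nat.le_floor hm
  have H : ∀ s ≤ t, embed pt (transcript (capped (A.queryRule r pt) ⌊m⌋₊) s fun i => w i)
      = A.history r (fun s => (pt (w s).1, (w s).2)) s := fun s hs =>
    (A.history_eq_embed r pt w ((A.numQueries_mono r _ hs).trans hM)).symm
  have hnone : ∀ s < t, A.decision r pt s
      (transcript (capped (A.queryRule r pt) ⌊m⌋₊) s fun i => w i) = none := by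
    intro s hs
    induction s with
    | zero =>
      have := hn 0 hs
      rw [decision, H 0 t.zero_le]
      simp_all
    | succ s ih =>
      have := hn (s + 1) hs
      rw [decision_transcript_succ, ih (by omega), H _ hs.le]
      simp_all
  refine ⟨t, _, ?_, he⟩
  dsimp only at hh
  cases t with
  | zero =>
    rw [decision, H 0 le_rfl, if_pos hh]
    rfl
  | succ t =>
    rw [decision_transcript_succ, hnone t t.lt_succ_self, H _ le_rfl, if_pos hh]
    rfl

lemma measurable_history (A : ActiveLearner R X) (t : ℕ) :
    Measurable fun ω : R × (ℕ → X × Bool) => A.history ω.1 ω.2 t := by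
  induction t with
  | zero => exact measurable_pi_iff.2 fun i => i.elim0
  | succ t ih =>
    refine measurable_pi_iff.2 fun i => ?_
    refine Fin.lastCases ?_ (fun i => ?_) i
    · simp only [history, Fin.snoc_last]
      have hz : Measurable fun ω : R × (ℕ → X × Bool) => ω.2 t := by fun_prop
      refine hz.fst.prodMk (Measurable.ite ?_ ?_ measurable_const)
      · have := (A.measurable_query t).comp ((measurable_fst.prodMk ih).prodMk hz.fst)
        exact this (measurableSet_singleton true)
      · exact (measurable_of_finite (some : Bool → Option Bool)).comp hz.snd
    · simp only [history, Fin.snoc_castSucc]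
      exact (measurable_pi_apply i).comp ih

lemma measurableSet_successEvent (A : ActiveLearner R X) (D : Measure (X × Bool))
    [IsProbabilityMeasure D] (a m : ℝ) : MeasurableSet (A.successEvent D a m) := by
  have hh : ∀ t, Measurable fun ω : R × (ℕ → X × Bool) => A.halt t ω.1 (A.history ω.1 ω.2 t) :=
    fun t => (A.measurable_halt t).comp (measurable_fst.prodMk (A.measurable_history t))
  have hnum : ∀ t, Measurable fun ω : R × (ℕ → X × Bool) => A.numQueries ω.1 ω.2 t := by
    intro t
    induction t with
    | zero => simp [numQueries]
    | succ t ih =>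
      simp only [numQueries_succ]
      refine ih.add (Measurable.ite ?_ measurable_const measurable_const)
      have := (A.measurable_query t).comp ((measurable_fst.prodMk (A.measurable_history t)).prodMk
        (show Measurable fun ω : R × (ℕ → X × Bool) => (ω.2 t).1 by fun_prop))
      exact this (measurableSet_singleton true)
  have herr : ∀ t, Measurable fun ω : R × (ℕ → X × Bool) =>
      err D (A.output t ω.1 (A.history ω.1 ω.2 t)) := by
    intro t
    have h1 : MeasurableSet {q : (R × (ℕ → X × Bool)) × (X × Bool) |
        A.output t q.1.1 (A.history q.1.1 q.1.2 t) q.2.1 ≠ q.2.2} := by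
      have h2 : Measurable fun q : (R × (ℕ → X × Bool)) × (X × Bool) =>
          A.output t q.1.1 (A.history q.1.1 q.1.2 t) q.2.1 :=
        (A.measurable_output t).comp ((measurable_fst.fst.prodMk
          ((A.measurable_history t).comp measurable_fst)).prodMk measurable_snd.fst)
      exact (measurableSet_eq_fun h2 measurable_snd.snd).compl
    exact (measurable_measure_prodMk_left (ν := D) h1).ennreal_toReal
  have : A.successEvent D a m = ⋃ t, ({ω | A.halt t ω.1 (A.history ω.1 ω.2 t) = true} ∩
      ⋂ s : Fin t, {ω | A.halt s ω.1 (A.history ω.1 ω.2 s) = false}) ∩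
      ({ω | (A.numQueries ω.1 ω.2 t : ℝ) ≤ m} ∩
        {ω | err D (A.output t ω.1 (A.history ω.1 ω.2 t)) ≤ a}) := by
    ext ω
    simp only [successEvent, HaltsAt, Set.mem_ofPred_eq, Set.mem_iUnion, Set.mem_inter_iff,
      Set.mem_iInter, Fin.forall_iff]
  rw [this]
  refine MeasurableSet.iUnion fun t => (((hh t) (measurableSet_singleton true)).inter
    (MeasurableSet.iInter fun s : Fin t => (hh s) (measurableSet_singleton false))).inter
    (MeasurableSet.inter ?_ (measurableSet_le (herr t) measurable_const))
  exact measurableSet_le (measurable_from_top.comp (hnum t)) measurable_const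

end ActiveLearner

end Discretization

lemma exists_shattered_points {X : Type*} {H : Set (X → Bool)} {d : ℕ} (hd : vcDim H = (d : ℕ∞))
    (h0 : 0 < d) : ∃ pt : Fin d → X, ∀ v : Fin d → Bool, ∃ h ∈ H, ∀ i, h (pt i) = v i := by
  obtain ⟨S, hS, hc⟩ : ∃ S : Finset X, Shatters H S ∧ S.card = d := by
    -- The supremum is attained: with no shattered set of size `d`, all sizes would be at most `d -
    -- 1`.
    by_contra! hne
    have hle : vcDim H ≤ ((d - 1 : ℕ) : ℕ∞) := by
      refine iSup₂_le fun S hS => ?_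
      have h1 : (S.card : ℕ∞) ≤ d := hd ▸ le_iSup₂ (f := fun (S : Finset X)
        (_ : Shatters H S) => (S.card : ℕ∞)) S hS
      have h2 : S.card ≤ d := by exact_mod_cast h1
      have := hne S hS
      exact_mod_cast (show S.card ≤ d - 1 by omega)
    rw [hd] at hle
    have : d ≤ d - 1 := by exact_mod_cast hle
    omega
  let e := S.equivFinOfCardEq hc
  have hinj : Function.Injective fun i => (e.symm i : X) :=
    Subtype.val_injective.comp e.symm.injective
  refine ⟨fun i => e.symm i, fun v => ?_⟩
  obtain ⟨h, hH, hv⟩ := hS (Function.extend (fun i => (e.symm i : X)) v fun _ => false)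
  exact ⟨h, hH, fun i => by rw [hv _ (e.symm i).2, hinj.extend_apply]⟩

/-! ### Conditioning on the seed, and errors of pushed-forward distributions -/

section FixedSeed

variable {R X J : Type*} [MeasurableSpace R] [MeasurableSpace X] [Fintype J] [MeasurableSpace J]
  [MeasurableSingletonClass J]

open Classical in
/-- It suffices to bound the success probability for fixed seeds, finite horizons, and capped
numbers of labels. -/
lemma ActiveLearner.sum_successProb_le {B : Type*} [Fintype B] (A : ActiveLearner R X)
    (ρ : Measure R) [IsProbabilityMeasure ρ] (pt : J → X) (ν : B → Measure (J × Bool))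
    [∀ b, IsProbabilityMeasure (ν b)] (D : B → ProbabilityMeasure (X × Bool))
    (hD : ∀ b, (D b : Measure (X × Bool)) = (ν b).map fun k => (pt k.1, k.2)) (a m : ℝ) {C : ℝ}
    (hC : ∀ r t, ∑ b, expect (fun k => (ν b).real {k}) (capped (A.queryRule r pt) ⌊m⌋₊) t
      (fun h => if ∃ g ∈ A.decision r pt t h, err (D b : Measure (X × Bool)) g ≤ a then 1 else 0)
        ≤ C) :
    ∑ b, A.successProb ρ (D b) a m ≤ C := by
  have hC0 : 0 ≤ C := by
    obtain ⟨r⟩ : Nonempty R := ρ.nonempty_of_neZero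
    refine le_trans (Finset.sum_nonneg fun b _ => ?_) (hC r 0)
    refine Finset.sum_nonneg fun z _ => mul_nonneg (Finset.prod_nonneg fun _ _ => measureReal_nonneg)
      ?_
    dsimp only
    split_ifs <;> norm_num
  -- The first returned classifier is kept in `decision`, so these events increase with the horizon
  -- `t`.
  let U : B → R → ℕ → Set (ℕ → J × Bool) := fun b r t => {w | ∃ g ∈ A.decision r pt t
    (transcript (capped (A.queryRule r pt) ⌊m⌋₊) t fun s => w s),
      err (D b : Measure (X × Bool)) g ≤ a}
  have hmono : ∀ b r, Monotone (U b r) := fun b r => monotone_nat_of_le_succ fun t w hw => by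
    obtain ⟨g, hg, he⟩ := hw
    refine ⟨g, ?_, he⟩
    rw [Option.mem_def] at hg
    rw [A.decision_transcript_succ, hg]
    rfl
  have hU : ∀ b r t, (Measure.infinitePi fun _ : ℕ => ν b).real (U b r t)
      = expect (fun k => (ν b).real {k}) (capped (A.queryRule r pt) ⌊m⌋₊) t (fun h =>
        if ∃ g ∈ A.decision r pt t h, err (D b : Measure (X × Bool)) g ≤ a then 1 else 0) :=
    fun b r t => by
    refine (infinitePi_real_prefix (ν b) t {z | ∃ g ∈ A.decision r pt t
      (transcript (capped (A.queryRule r pt) ⌊m⌋₊) t z), err (D b : Measure (X × Bool)) g ≤ a}).trans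
      ?_
    simp only [expect, Set.mem_ofPred_eq]
    congr!
  have hφ : Measurable fun k : J × Bool => (pt k.1, k.2) := measurable_of_finite _
  have hsec : ∀ b r, (Measure.infinitePi fun _ : ℕ => (D b : Measure (X × Bool)))
      (Prod.mk r ⁻¹' A.successEvent (D b : Measure (X × Bool)) a m)
      ≤ ⨆ t, (Measure.infinitePi fun _ : ℕ => ν b) (U b r t) := fun b r => by
    have hmeas : MeasurableSet (Prod.mk r ⁻¹' A.successEvent (D b : Measure (X × Bool)) a m) :=
      measurable_prodMk_left (A.measurableSet_successEvent _ a m)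
    have hpi : (Measure.infinitePi fun _ : ℕ => (D b : Measure (X × Bool)))
        = (Measure.infinitePi fun _ : ℕ => ν b).map fun w s => (pt (w s).1, (w s).2) := by
      rw [Measure.infinitePi_map_pi (fun _ : ℕ => ν b) (f := fun _ k => (pt k.1, k.2)) fun _ => hφ]
      congr 1
      exact funext fun _ => hD b
    rw [hpi, Measure.map_apply (by fun_prop) hmeas, ← (hmono b r).measure_iUnion]
    refine measure_mono fun w hw => ?_
    obtain ⟨t, ht⟩ := A.exists_decision_of_mem_successEvent r pt w _ hw
    exact Set.mem_iUnion.2 ⟨t, ht⟩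
  have hle : ∑ b, (ρ.prod (Measure.infinitePi fun _ : ℕ => (D b : Measure (X × Bool))))
      (A.successEvent (D b : Measure (X × Bool)) a m) ≤ ENNReal.ofReal C := by
    simp_rw [Measure.prod_apply (A.measurableSet_successEvent _ a m)]
    rw [← lintegral_finsetSum _ fun b _ =>
      measurable_measure_prodMk_left (A.measurableSet_successEvent _ a m)]
    calc _ ≤ ∫⁻ _, ENNReal.ofReal C ∂ρ := by
          refine lintegral_mono fun r => ?_
          refine (Finset.sum_le_sum fun b _ => hsec b r).trans ?_
          -- Monotonicity lets one horizon serve all `b` at once, so the bound on the sum at each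
          -- `t` suffices.
          rw [ENNReal.finsetSum_iSup_of_monotone
            (f := fun b t => (Measure.infinitePi fun _ : ℕ => ν b) (U b r t)) fun b _ _ h => measure_mono (hmono b r h)]
          refine iSup_le fun t => ?_
          refine le_trans (le_of_eq ?_) (ENNReal.ofReal_le_ofReal (hC r t))
          rw [ENNReal.ofReal_sum_of_nonneg fun b _ => (hU b r t) ▸ measureReal_nonneg]
          exact Finset.sum_congr rfl fun b _ => by rw [← hU, ofReal_measureReal]
      _ = ENNReal.ofReal C := by simp
  simp only [ActiveLearner.successProb, measureReal_def]
  rw [← ENNReal.toReal_sum fun b _ => measure_ne_top _ _]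
  exact ENNReal.toReal_le_of_le_ofReal hC0 hle

lemma err_map_of_measurable (ν : Measure (J × Bool)) [IsFiniteMeasure ν] (pt : J → X)
    {h : X → Bool} (hh : Measurable h) :
    err (ν.map fun k => (pt k.1, k.2)) h
      = ∑ k, ν.real {k} * if h (pt k.1) ≠ k.2 then 1 else 0 := by
  have hφ : Measurable fun k : J × Bool => (pt k.1, k.2) := measurable_of_finite _
  have hm : MeasurableSet {z : X × Bool | h z.1 ≠ z.2} :=
    (measurableSet_eq_fun (hh.comp measurable_fst) measurable_snd).compl
  rw [err, map_measureReal_apply hφ hm]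
  have : (fun k : J × Bool => (pt k.1, k.2)) ⁻¹' {z | h z.1 ≠ z.2}
      = ((Finset.univ.filter fun k : J × Bool => h (pt k.1) ≠ k.2 : Finset (J × Bool)) :
        Set (J × Bool)) := by
    ext; simp
  rw [this, ← sum_measureReal_singleton, Finset.sum_filter]
  simp

/-- For a non-measurable `h` the pushforward is only an outer measure of the error set, but this
direction survives and is all that the lower bound on errors needs. -/
lemma le_err_map (ν : Measure (J × Bool)) [IsFiniteMeasure ν] (pt : J → X) (h : X → Bool) :
    ∑ k, ν.real {k} * (if h (pt k.1) ≠ k.2 then 1 else 0)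
      ≤ err (ν.map fun k => (pt k.1, k.2)) h := by
  have hφ : Measurable fun k : J × Bool => (pt k.1, k.2) := measurable_of_finite _
  have h1 := Measure.le_map_apply (μ := ν) hφ.aemeasurable {z | h z.1 ≠ z.2}
  refine le_trans (le_of_eq ?_) (ENNReal.toReal_mono (measure_ne_top _ _) h1)
  have : (fun k : J × Bool => (pt k.1, k.2)) ⁻¹' {z | h z.1 ≠ z.2}
      = ((Finset.univ.filter fun k : J × Bool => h (pt k.1) ≠ k.2 : Finset (J × Bool)) :
        Set (J × Bool)) := by
    ext; simp
  rw [this, ← measureReal_def, ← sum_measureReal_singleton, Finset.sum_filter]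
  simp

end FixedSeed

/-! ### Sizes of Hamming balls of radius `n/4` -/

section Counting

variable {n : ℕ}

/-- The number of coordinates at which two labellings differ. -/
def mistakes (v b : Fin n → Bool) : ℕ := ∑ i, if v i ≠ b i then 1 else 0

/-- Coordinatewise `xor` with `v` is an isometry of the cube that moves the centre. -/
lemma card_mistakes_eq (v : Fin n → Bool) :
    (Finset.univ.filter fun b => 4 * mistakes v b ≤ n).card
      = (Finset.univ.filter fun b : Fin n → Bool => 4 * mistakes (fun _ => false) b ≤ n).card := by
  refine Finset.card_bij (fun b _ i => xor (v i) (b i)) ?_ ?_ ?_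
  · intro b hb
    have : mistakes (fun _ => false) (fun i => xor (v i) (b i)) = mistakes v b :=
      Finset.sum_congr rfl fun i _ => by cases hv : v i <;> cases hb : b i <;> simp [hv, hb]
    simpa [this] using hb
  · intro b _ b' _ h
    funext i
    simpa using congrFun h i
  · intro b hb
    refine ⟨fun i => xor (v i) (b i), ?_, by simp⟩
    have : mistakes v (fun i => xor (v i) (b i)) = mistakes (fun _ => false) b :=
      Finset.sum_congr rfl fun i _ => by cases hv : v i <;> cases hb : b i <;> simp [hv, hb]
    simpa [this] using hb

/-- Chernoff's bound with weight `(3/4)^4 = 81/256` per mistake: the weights sum to `(1 + 81/256)^n`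
over the cube and are at least `(3/4)^n` on the ball. -/
lemma card_mistakes_le_pow (v : Fin n → Bool) :
    ((Finset.univ.filter fun b => 4 * mistakes v b ≤ n).card : ℝ) ≤ (337 / 384) ^ n * 2 ^ n := by
  have hsum : ∑ b : Fin n → Bool, ((3 / 4 : ℝ) ^ 4) ^ mistakes v b = (337 / 256) ^ n := by
    simp only [mistakes, ← Finset.prod_pow_eq_pow_sum]
    rw [← Fintype.piFinset_univ, ← Finset.prod_univ_sum (fun _ : Fin n => (Finset.univ : Finset Bool))
      fun i y => ((3 / 4 : ℝ) ^ 4) ^ (if v i ≠ y then 1 else 0)]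
    rw [Finset.prod_congr rfl (g := fun _ => (337 / 256 : ℝ)) fun i _ => ?_]
    · simp [div_pow]
    · cases v i <;> norm_num
  have h1 : ((Finset.univ.filter fun b => 4 * mistakes v b ≤ n).card : ℝ) * (3 / 4) ^ n
      ≤ (337 / 256) ^ n := by
    rw [← hsum, ← nsmul_eq_mul, ← Finset.sum_const]
    refine le_trans (Finset.sum_le_sum fun b hb => ?_)
      (Finset.sum_le_univ_sum_of_nonneg fun b => by positivity)
    rw [← pow_mul]
    exact pow_le_pow_of_le_one (by norm_num) (by norm_num) (Finset.mem_filter.1 hb).2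
  rw [← le_div_iff₀ (by positivity), ← div_pow] at h1
  refine h1.trans (le_of_eq ?_)
  rw [← mul_pow]
  norm_num

/-- The balls around `v` and its antipode have equal size and are disjoint, since the two distances
add up to `n`. -/
lemma card_mistakes_le_half (hn : 1 ≤ n) (v : Fin n → Bool) :
    ((Finset.univ.filter fun b => 4 * mistakes v b ≤ n).card : ℝ) ≤ 1 / 2 * 2 ^ n := by
  set S := Finset.univ.filter fun b => 4 * mistakes v b ≤ n
  set S' := Finset.univ.filter fun b => 4 * mistakes (fun i => !v i) b ≤ n
  have hadd : ∀ b, mistakes v b + mistakes (fun i => !v i) b = n := fun b => by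
    rw [mistakes, mistakes, ← Finset.sum_add_distrib,
      Finset.sum_congr rfl (g := fun _ => 1) fun i _ => by cases v i <;> cases b i <;> rfl]
    simp
  have hdisj : Disjoint S S' := Finset.disjoint_left.2 fun b h1 h2 => by
    have := (Finset.mem_filter.1 h1).2
    have := (Finset.mem_filter.1 h2).2
    have := hadd b
    omega
  have hcard : S'.card = S.card := (card_mistakes_eq _).trans (card_mistakes_eq v).symm
  have h2 : S.card + S'.card ≤ 2 ^ n := by
    rw [← Finset.card_union_of_disjoint hdisj]
    exact (Finset.card_le_univ _).trans (by simp)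
  rw [hcard] at h2
  have h3 : (S.card : ℝ) + S.card ≤ 2 ^ n := by exact_mod_cast h2
  linarith

lemma card_mistakes_le_of_two_le (hn : 2 ≤ n) (v : Fin n → Bool) :
    ((Finset.univ.filter fun b => 4 * mistakes v b ≤ n).card : ℝ) ≤ 15 / 32 * 2 ^ n := by
  -- Six is the first exponent at which `(337/384)^n` falls below `15/32`; the smaller cubes are
  -- checked by computation.
  rcases le_or_gt 6 n with h6 | h6
  · refine (card_mistakes_le_pow v).trans (mul_le_mul_of_nonneg_right ?_ (by positivity))
    exact (pow_le_pow_of_le_one (by norm_num) (by norm_num) h6).trans (by norm_num)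
  · rw [card_mistakes_eq]
    have : 32 * (Finset.univ.filter fun b : Fin n → Bool => 4 * mistakes (fun _ => false) b ≤ n).card
        ≤ 15 * 2 ^ n := by
      interval_cases n <;> decide +kernel
    have h' : (32 : ℝ) * (Finset.univ.filter fun b : Fin n → Bool =>
        4 * mistakes (fun _ => false) b ≤ n).card ≤ 15 * 2 ^ n := by exact_mod_cast this
    linarith

end Counting

lemma exists_rate {δ : ℝ} (hδ : 0 < δ) : ∃ c : ℝ, 0 < c ∧ ∀ n : ℕ,
    (337 / 384 : ℝ) ^ n * (Real.exp (c * n) - 1) ≤ δ ^ 2 := by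
  -- The bound `1/100` ensures `(337/384) * exp x ≤ 9/10`; the `9` in `δ ^ 2 / 9` pays for `n *
  -- (9/10)^n ≤ 9`, which is Bernoulli's inequality.
  refine ⟨min (1 / 100) (δ ^ 2 / 9), by positivity, fun n => ?_⟩
  set x := min (1 / 100) (δ ^ 2 / 9)
  have hx0 : 0 < x := by positivity
  have hx1 : x ≤ 1 / 100 := min_le_left _ _
  have hx2 : x ≤ δ ^ 2 / 9 := min_le_right _ _
  have h1 : Real.exp (x * n) - 1 ≤ x * n * Real.exp (x * n) := by
    have h := Real.add_one_le_exp (-(x * n))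
    have h' := mul_le_mul_of_nonneg_right h (Real.exp_pos (x * n)).le
    rw [← Real.exp_add, neg_add_cancel, Real.exp_zero] at h'
    linarith
  have h2 : 337 / 384 * Real.exp x ≤ 9 / 10 := by
    have h := Real.add_one_le_exp (-x)
    have h' := mul_le_mul_of_nonneg_right h (Real.exp_pos x).le
    rw [← Real.exp_add, neg_add_cancel, Real.exp_zero] at h'
    nlinarith [Real.exp_pos x]
  have h3 : (n : ℝ) * (9 / 10) ^ n ≤ 9 := by
    have h := one_add_mul_le_pow (a := (1 / 9 : ℝ)) (by norm_num) n
    have h' : ((1 : ℝ) + 1 / 9) ^ n * (9 / 10) ^ n = 1 := by rw [← mul_pow]; norm_num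
    have h'' : (0 : ℝ) < (9 / 10) ^ n := by positivity
    nlinarith
  calc _ ≤ (337 / 384 : ℝ) ^ n * (x * n * Real.exp (x * n)) := by gcongr
    _ = x * (n * (337 / 384 * Real.exp x) ^ n) := by
      rw [mul_pow, ← Real.exp_nat_mul, mul_comm (n : ℝ) x]
      ring
    _ ≤ x * (n * (9 / 10) ^ n) := by gcongr
    _ ≤ x * 9 := by gcongr
    _ ≤ δ ^ 2 := by linarith

/-! ### The hard instances and the average success on them -/

section HardFamily

variable {n : ℕ}

/-- The weights of the hard instances without any information in the labels: a point `0` of mass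
`1 - β` with a certain label, and `n` points of total mass `β` with fair random labels. -/
noncomputable def baseWeight (β : ℝ) (k : Fin (n + 1) × Bool) : ℝ :=
  Fin.cases (motive := fun _ => ℝ) (if k.2 then 1 - β else 0) (fun _ => β / (2 * n)) k.1

/-- The density, with respect to `baseWeight`, of the hard instance where the label at `i + 1` is
`b i` with probability `1 / 2 + γ`. -/
noncomputable def labelBias (γ : ℝ) (b : Fin n → Bool) (k : Fin (n + 1) × Bool) : ℝ :=
  Fin.cases (motive := fun _ => ℝ) 1 (fun i => if k.2 = b i then 1 + 2 * γ else 1 - 2 * γ) k.1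

lemma baseWeight_nonneg {β : ℝ} (h0 : 0 ≤ β) (h1 : β ≤ 1) (k : Fin (n + 1) × Bool) :
    0 ≤ baseWeight β k := by
  obtain ⟨j, y⟩ := k
  refine Fin.cases ?_ (fun i => ?_) j
  · simp only [baseWeight, Fin.cases_zero]
    split_ifs <;> linarith
  · simp only [baseWeight, Fin.cases_succ]
    positivity

lemma sum_baseWeight (hn : n ≠ 0) (β : ℝ) : ∑ k : Fin (n + 1) × Bool, baseWeight β k = 1 := by
  rw [Fintype.sum_prod_type, Fin.sum_univ_succ]
  simp only [baseWeight, Fin.cases_zero, Fin.cases_succ, Fintype.sum_bool]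
  simp
  field_simp
  ring

lemma labelBias_nonneg {γ : ℝ} (h0 : 0 ≤ γ) (h1 : γ ≤ 1 / 2) (b : Fin n → Bool)
    (k : Fin (n + 1) × Bool) : 0 ≤ labelBias γ b k := by
  obtain ⟨j, y⟩ := k
  refine Fin.cases ?_ (fun i => ?_) j
  · simp [labelBias]
  · simp only [labelBias, Fin.cases_succ]
    split_ifs <;> linarith

lemma sum_baseWeight_mul_labelBias (β γ : ℝ) (b : Fin n → Bool) (j : Fin (n + 1)) :
    ∑ y, baseWeight β (j, y) * labelBias γ b (j, y) = ∑ y, baseWeight β (j, y) := by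
  refine Fin.cases ?_ (fun i => ?_) j
  · simp [labelBias]
  · simp only [baseWeight, labelBias, Fin.cases_succ, Fintype.sum_bool]
    cases b i <;> simp <;> ring

/-- At a fair label the second moment is `((1 + 2γ)² + (1 - 2γ)²) / 2 = 1 + 4γ²`; at the point `0`
the density is `1`. -/
lemma sum_baseWeight_mul_labelBias_sq_le {β : ℝ} (h1 : β ≤ 1) (γ : ℝ) (b : Fin n → Bool)
    (j : Fin (n + 1)) :
    ∑ y, baseWeight β (j, y) * labelBias γ b (j, y) ^ 2
      ≤ (1 + 4 * γ ^ 2) * ∑ y, baseWeight β (j, y) := by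
  refine Fin.cases ?_ (fun i => ?_) j
  · simp [labelBias, baseWeight]
    nlinarith [sq_nonneg γ]
  · simp only [baseWeight, labelBias, Fin.cases_succ, Fintype.sum_bool]
    refine le_of_eq ?_
    cases b i <;> simp <;> ring

lemma sum_disagreement (hn : n ≠ 0) (β γ : ℝ) (b : Fin n → Bool) (v : Fin (n + 1) → Bool) :
    ∑ k, baseWeight β k * labelBias γ b k * (if v k.1 ≠ k.2 then 1 else 0)
      = (if v 0 then 0 else 1 - β) + β * (1 / 2 - γ)
        + 2 * (β * γ) * mistakes (fun i => v i.succ) b / n := by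
  have hi : ∀ i, ∑ y, baseWeight (n := n) β (i.succ, y) * labelBias γ b (i.succ, y)
      * (if v i.succ ≠ y then 1 else 0)
      = β / (2 * n) * (1 - 2 * γ) + β / (2 * n) * (4 * γ) * (if v i.succ ≠ b i then 1 else 0) := by
    intro i
    simp only [baseWeight, labelBias, Fin.cases_succ, Fintype.sum_bool]
    cases b i <;> cases v i.succ <;> simp <;> ring
  rw [Fintype.sum_prod_type, Fin.sum_univ_succ, Finset.sum_congr rfl fun i _ => hi i,
    Finset.sum_add_distrib, Finset.sum_const, ← Finset.mul_sum]
  have h0 : ∑ y, baseWeight (n := n) β (0, y) * labelBias γ b (0, y)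
      * (if v 0 ≠ y then 1 else 0) = if v 0 then 0 else 1 - β := by
    simp only [baseWeight, labelBias, Fin.cases_zero, Fintype.sum_bool]
    cases v 0 <;> simp
  rw [h0, mistakes]
  push_cast
  simp only [Finset.card_univ, Fintype.card_fin, nsmul_eq_mul]
  field_simp
  ring

/-- The hard instances, as distributions on indices of points and labels. -/
lemma exists_hardInstance (hn : n ≠ 0) {β γ : ℝ} (hβ0 : 0 ≤ β) (hβ1 : β ≤ 1) (hγ0 : 0 ≤ γ)
    (hγ1 : γ ≤ 1 / 2) (b : Fin n → Bool) :
    ∃ ν : Measure (Fin (n + 1) × Bool), IsProbabilityMeasure ν ∧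
      ∀ k, ν.real {k} = baseWeight β k * labelBias γ b k := by
  have h0 : ∀ k, 0 ≤ baseWeight β k * labelBias γ b k := fun k =>
    mul_nonneg (baseWeight_nonneg hβ0 hβ1 k) (labelBias_nonneg hγ0 hγ1 b k)
  have h1 : ∑ k, baseWeight β k * labelBias γ b k = 1 := by
    rw [← sum_baseWeight hn β, Fintype.sum_prod_type, Fintype.sum_prod_type]
    exact Finset.sum_congr rfl fun j _ => sum_baseWeight_mul_labelBias β γ b j
  refine ⟨(PMF.ofFintype (fun k => ENNReal.ofReal (baseWeight β k * labelBias γ b k)) ?_).toMeasure,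
    inferInstance, fun k => ?_⟩
  · rw [← ENNReal.ofReal_sum_of_nonneg fun k _ => h0 k, h1, ENNReal.ofReal_one]
  · rw [measureReal_def, PMF.toMeasure_apply_singleton _ _ (measurableSet_singleton k),
      PMF.ofFintype_apply, ENNReal.toReal_ofReal (h0 k)]

/-- The average success probability of a learner that sees at most `M` labels, in terms of the
fraction `q` of labellings that are close to a given one. -/
lemma sum_expect_hardInstance_le (hn : n ≠ 0) {β γ : ℝ} (hβ0 : 0 ≤ β) (hβ1 : β ≤ 1)
    (q : (t : ℕ) → History (Fin (n + 1)) t → Fin (n + 1) → Bool) (M t : ℕ)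
    (f : (Fin n → Bool) → History (Fin (n + 1)) t → ℝ) (hf : ∀ b h, f b h = 0 ∨ f b h = 1)
    (v : History (Fin (n + 1)) t → Fin n → Bool)
    (hv : ∀ b h, f b h = 1 → 4 * mistakes (v h) b ≤ n) {q₀ δ x : ℝ} (hδ : 0 < δ)
    (hq : ∀ v : Fin n → Bool,
      ((Finset.univ.filter fun b => 4 * mistakes v b ≤ n).card : ℝ) ≤ q₀ * 2 ^ n)
    (hM : 4 * γ ^ 2 * M ≤ x * n)
    (hx : (337 / 384 : ℝ) ^ n * (Real.exp (x * n) - 1) ≤ δ ^ 2) :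
    ∑ b, expect (fun k => baseWeight β k * labelBias γ b k) (capped q M) t (f b)
      ≤ (q₀ + δ) * 2 ^ n := by
  set ρ : ℝ := (337 / 384) ^ n with hρ
  have hρ0 : 0 < ρ := by positivity
  have hcount : ∀ h, ∑ b, f b h
      ≤ (Finset.univ.filter fun b => 4 * mistakes (v h) b ≤ n).card := fun h => by
    rw [Finset.card_filter, Nat.cast_sum]
    refine Finset.sum_le_sum fun b _ => ?_
    rcases hf b h with h0 | h1
    · rw [h0]
      positivity
    · rw [h1, if_pos (hv b h h1), Nat.cast_one]
  -- Both bounds on the ball matter: `q₀` gives the main term, and the exponentially small `ρ`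
  -- controls the error term.
  have hC : ∀ h, ∑ b, f b h ≤ min q₀ ρ * 2 ^ n := fun h => (hcount h).trans <| by
    rw [min_mul_of_nonneg _ _ (by positivity)]
    exact le_min (hq _) (card_mistakes_le_pow _)
  have hκ : (1 + 4 * γ ^ 2) ^ M ≤ Real.exp (x * n) := by
    refine le_trans ?_ (Real.exp_le_exp.2 hM)
    rw [mul_comm (4 * γ ^ 2) (M : ℝ), Real.exp_nat_mul]
    refine pow_le_pow_left₀ (by positivity) ?_ M
    linarith [Real.add_one_le_exp (4 * γ ^ 2)]
  -- The choice `lam = δ / ρ` makes each of the two error terms at most `δ / 2` times `2 ^ n`.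
  have key := sum_expect_le (fun k => baseWeight_nonneg hβ0 hβ1 k) (sum_baseWeight hn β)
    (labelBias γ) (κ := 1 + 4 * γ ^ 2) (by nlinarith [sq_nonneg γ])
    (sum_baseWeight_mul_labelBias β γ) (sum_baseWeight_mul_labelBias_sq_le hβ1 γ) q M t f hf hC
    (lam := δ / ρ) (by positivity)
  refine key.trans ?_
  have h1 : min q₀ ρ * 2 ^ n ≤ q₀ * 2 ^ n := by gcongr; exact min_le_left _ _
  have h2 : δ / ρ * (min q₀ ρ * 2 ^ n) / 2 ≤ δ / 2 * 2 ^ n := by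
    calc _ ≤ δ / ρ * (ρ * 2 ^ n) / 2 := by gcongr; exact min_le_right _ _
      _ = δ / 2 * 2 ^ n := by field_simp
  have h3 : ((1 + 4 * γ ^ 2) ^ M - 1) / (2 * (δ / ρ)) ≤ δ / 2 := by
    rw [div_le_iff₀ (by positivity)]
    have : δ / 2 * (2 * (δ / ρ)) = δ ^ 2 / ρ := by field_simp
    rw [this, le_div_iff₀ hρ0]
    nlinarith
  have h4 : (Fintype.card (Fin n → Bool) : ℝ) = 2 ^ n := by simp
  rw [h4]
  have h5 := mul_le_mul_of_nonneg_left h3 (a := (2 : ℝ) ^ n) (by positivity)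
  linarith

end HardFamily

end ActiveLearning

/-! ### Choice of parameters and conclusion -/

open ActiveLearning in
theorem theorem4 (p : ℝ) (hp : 1 / 2 ≤ p) :
    ∃ c : ℝ, 0 < c ∧
      ∀ (X : Type*) [MeasurableSpace X] (H : Set (X → Bool)), (∀ h ∈ H, Measurable h) →
      ∀ d : ℕ, vcDim H = (d : ℕ∞) → 1 < d → (d = 2 → 1 / 2 < p) →
      ∀ η ε : ℝ, 0 < ε → 2 * ε ≤ η → η ≤ 1 / 4 →
      ∃ (ι : Type) (_ : Fintype ι) (_ : Nonempty ι) (D : ι → ProbabilityMeasure (X × Bool)),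
        (∀ i, IsLeast (err (D i : Measure (X × Bool)) '' H) η) ∧
        ∀ (R : Type*) [MeasurableSpace R] (ρ : Measure R) [IsProbabilityMeasure ρ]
          (A : ActiveLearner R X),
          (∑ i, A.successProb ρ (D i) (η + ε) (c * (d * η ^ 2 / ε ^ 2))) / Fintype.card ι < p := by
  -- For `n = 1` the ball is exactly half of the cube, hence the exception at `d = 2`; from `n = 2`
  -- on, `15/32` leaves room below `p = 1/2`.
  obtain ⟨q₀, hq₀, hq⟩ : ∃ q₀ < p, ∀ n : ℕ, 1 ≤ n → (n = 1 → 1 / 2 < p) → ∀ v : Fin n → Bool,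
      ((Finset.univ.filter fun b => 4 * mistakes v b ≤ n).card : ℝ) ≤ q₀ * 2 ^ n := by
    by_cases h : 1 / 2 < p
    · exact ⟨1 / 2, h, fun n hn _ v => card_mistakes_le_half hn v⟩
    · refine ⟨15 / 32, by linarith, fun n hn h1 v => card_mistakes_le_of_two_le ?_ v⟩
      have : n ≠ 1 := fun e => h (h1 e)
      omega
  set δ := (p - q₀) / 2 with hδdef
  have hδ : 0 < δ := by linarith
  obtain ⟨x, hx0, hx⟩ := exists_rate hδ
  -- One factor `4` cancels that of `4γ²`, and the remaining `2` absorbs `n + 1 ≤ 2n`.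
  refine ⟨x / 8, by positivity, ?_⟩
  intro X _ H hH d hd h1d h2d η ε hε hεη hη
  obtain ⟨n, rfl⟩ : ∃ n, d = n + 1 := ⟨d - 1, by omega⟩
  have hn : n ≠ 0 := by omega
  have hn1 : (1 : ℝ) ≤ n := by exact_mod_cast Nat.one_le_iff_ne_zero.2 hn
  obtain ⟨pt, hpt⟩ := exists_shattered_points hd (by omega)
  have hη0 : 0 < η := by linarith
  -- Solves `β(1/2 - γ) = η` and `βγ = 2ε`; the assumptions on `η` and `ε` give `β ≤ 4η ≤ 1`.
  set β := 2 * η + 4 * ε with hβ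
  set γ := ε / (η + 2 * ε) with hγ
  have hβ0 : 0 ≤ β := by positivity
  have hβ1 : β ≤ 1 := by linarith
  have hγ0 : 0 ≤ γ := by positivity
  have hγ1 : γ ≤ 1 / 2 := by rw [hγ, div_le_iff₀ (by positivity)]; linarith
  have hβγ : β * γ = 2 * ε := by rw [hβ, hγ]; field_simp; ring
  choose ν hνp hν using exists_hardInstance (n := n) hn hβ0 hβ1 hγ0 hγ1
  have hφ : Measurable fun k : Fin (n + 1) × Bool => (pt k.1, k.2) := measurable_of_finite _
  let D : (Fin n → Bool) → ProbabilityMeasure (X × Bool) := fun b =>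
    ⟨(ν b).map fun k => (pt k.1, k.2), Measure.isProbabilityMeasure_map hφ.aemeasurable⟩
  have hle : ∀ b h, (if h (pt 0) then 0 else 1 - β) + η
      + 4 * ε * mistakes (fun i : Fin n => h (pt i.succ)) b / n
      ≤ err (D b : Measure (X × Bool)) h := fun b h => by
    refine le_trans (le_of_eq ?_) (le_err_map (ν b) pt h)
    simp only [hν]
    rw [sum_disagreement hn β γ b fun j => h (pt j), hβγ, mul_sub, hβγ]
    ring
  have hlow : ∀ b h, η + 4 * ε * mistakes (fun i : Fin n => h (pt i.succ)) b / n
      ≤ err (D b : Measure (X × Bool)) h := fun b h => by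
    refine le_trans ?_ (hle b h)
    split_ifs <;> linarith
  refine ⟨Fin n → Bool, inferInstance, inferInstance, D, fun b => ⟨?_, ?_⟩, ?_⟩
  · obtain ⟨h, hh, hb⟩ := hpt (Fin.cons true b)
    refine ⟨h, hh, ?_⟩
    refine (err_map_of_measurable (ν b) pt (hH h hh)).trans ?_
    simp only [hν]
    rw [sum_disagreement hn β γ b fun j => h (pt j), hβγ, mul_sub, hβγ]
    simp only [hb, Fin.cons_zero, Fin.cons_succ, mistakes]
    simp
    ring
  · rintro _ ⟨h, -, rfl⟩
    refine le_trans ?_ (hlow b h)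
    have : 0 ≤ 4 * ε * mistakes (fun i : Fin n => h (pt i.succ)) b / n := by positivity
    linarith
  · intro R _ ρ _ A
    have hcard : (Fintype.card (Fin n → Bool) : ℝ) = 2 ^ n := by simp
    rw [hcard, div_lt_iff₀ (by positivity)]
    set m : ℝ := x / 8 * (((n + 1 : ℕ) : ℝ) * η ^ 2 / ε ^ 2) with hm
    have hbound : ∑ b, A.successProb ρ (D b) (η + ε) m ≤ (q₀ + δ) * 2 ^ n := by
      refine A.sum_successProb_le ρ pt ν D (fun _ => rfl) (η + ε) m fun r t => ?_
      simp only [hν]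
      refine sum_expect_hardInstance_le hn hβ0 hβ1 (A.queryRule r pt) ⌊m⌋₊ t _
        -- The default `false` is harmless: with no decision, `f` vanishes for every `b`.
        (fun b h => ?_) (fun h i => (A.decision r pt t h).elim false fun g => g (pt i.succ))
        (fun b h hf => ?_) hδ (hq n (by omega) fun e => h2d (by omega)) ?_ (hx n)
      · split_ifs
        · exact Or.inr rfl
        · exact Or.inl rfl
      · split_ifs at hf with hg
        · obtain ⟨g, hg, he⟩ := hg
          have h3 := (hlow b g).trans he
          rw [Option.mem_def] at hg
          simp only [hg, Option.elim_some]
          have h4 : 4 * ε * mistakes (fun i : Fin n => g (pt i.succ)) b / n ≤ ε := by linarith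
          rw [div_le_iff₀ (by linarith)] at h4
          have h5 : (4 * mistakes (fun i : Fin n => g (pt i.succ)) b : ℝ) ≤ n := by
            refine le_of_mul_le_mul_left ?_ hε
            linarith
          exact_mod_cast h5
        · norm_num at hf
      · have hm0 : 0 ≤ m := by positivity
        have hγε : γ ^ 2 * (η ^ 2 / ε ^ 2) ≤ 1 := by
          rw [hγ, div_pow, div_mul_div_comm, mul_comm (ε ^ 2), mul_div_mul_right _ _ (by positivity),
            div_le_one (by positivity)]
          gcongr
          linarith
        calc 4 * γ ^ 2 * ⌊m⌋₊ ≤ 4 * γ ^ 2 * m := by gcongr; exact Nat.floor_le hm0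
          _ = x / 2 * (n + 1 : ℝ) * (γ ^ 2 * (η ^ 2 / ε ^ 2)) := by
            rw [hm]; push_cast; ring
          _ ≤ x / 2 * (n + 1 : ℝ) * 1 := by gcongr
          _ ≤ x * n := by nlinarith
    refine hbound.trans_lt (mul_lt_mul_of_pos_right ?_ (by positivity))
    linarith
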